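/- Let $n \ge 2$. There exists a compact set $E \subset \mathbb{R}^n$ of Hausdorff dimension $\dim_H E = n/2$ such that no three distinct points $x, y, z \in E$ satisfy $\angle yxz = \pi/2$. Moreover, the same set $E$ contains no four points $x, y, z, v$ (coincidences among them allowed) with $x \ne y$, $z \ne v$ and $\langle x - y, z - v \rangle = 0$. -/

import Mathlib

/-!
The obstruction to `⟪x - y, z - v⟫ = 0` is integrality. If all four points lie in `N⁻¹ ℤⁿ`, the inner
product lies in `N⁻² ℤ`. Displace every point `p` of the lattice by `ψ p / N²`, where `ψ` is a small
Lipschitz map: the inner product becomes an element of `N⁻² ℤ` plus `N⁻²` times the first variation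
`⟪x - y, ψ z - ψ v⟫ + ⟪ψ x - ψ y, z - v⟫` (`innerVariation`), up to an error that is negligible if
the points are only known within `ε / N²` for small `ε`. As `ψ` is small, the variation has absolute
value less than `1 / 2`; so the inner product is nonzero as soon as the variation is not too close
to `0` (`inner_ne_zero_of_mem_nearLattice`).

No single `ψ` serves all quadruples, but countably many tent functions do
(`exists_innerVariation_ne_zero`), and they can be combined with countably many tolerances `ε` in
one sequence (`exists_displacements`). The set `E` consists of the points of the unit ball that lie,
for every `k`, within `ε k / N k ^ 2` of the lattice `(N k)⁻¹ ℤⁿ` as displaced by `ψ k`, where `N k`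
grows rapidly. It is an intersection of closed conditions, and no Cantor tree is needed to define
it.

The dimension of `E` is at most `n / 2` because `E` is covered by `O(N ^ n)` sets of diameter
`O(N ^ (-2))` (`dimH_le_of_subset_nearLattice`). It is at least `n / 2` because the mixed-radix digits
of a point of the cube `[0, 1)ⁿ` select a nested sequence of balls centred at displaced lattice
points, hence a point of `E`, and the inverse of this map is Hölder with every exponent
`r < 1 / 2` (`CantorScale.dist_le_mul_rpow`, `le_dimH_of_inverse_holder`).
-/

/-! ### Integrality of inner products -/

/-- The vector of `ℝⁿ` with integer coordinates `a`. -/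
noncomputable def intVec {n : ℕ} (a : Fin n → ℤ) : EuclideanSpace ℝ (Fin n) :=
  WithLp.toLp 2 fun i => (a i : ℝ)

@[simp] lemma intVec_apply {n : ℕ} (a : Fin n → ℤ) (i : Fin n) : intVec a i = (a i : ℝ) := rfl

lemma intVec_sub {n : ℕ} (a b : Fin n → ℤ) : intVec (a - b) = intVec a - intVec b := by
  ext i; simp

lemma inner_intVec {n : ℕ} (a b : Fin n → ℤ) :
    inner ℝ (intVec a) (intVec b) = ((∑ i, a i * b i : ℤ) : ℝ) := by
  simp [PiLp.inner_apply, mul_comm]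

/-- The points `x` for which `x - ψ x / N²` lies within `ε / N²` of the lattice `N⁻¹ ℤⁿ`. -/
def nearLattice {n : ℕ} (N : ℕ) (ψ : EuclideanSpace ℝ (Fin n) → EuclideanSpace ℝ (Fin n))
    (ε : ℝ) : Set (EuclideanSpace ℝ (Fin n)) :=
  {x | ∃ a : Fin n → ℤ, ‖(N : ℝ) ^ 2 • x - ψ x - (N : ℝ) • intVec a‖ ≤ ε}

/-- The first-order change of `⟪x - y, z - v⟫` when every point `p` moves by `ψ p`. -/
noncomputable def innerVariation {n : ℕ}
    (ψ : EuclideanSpace ℝ (Fin n) → EuclideanSpace ℝ (Fin n))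
    (x y z v : EuclideanSpace ℝ (Fin n)) : ℝ :=
  inner ℝ (x - y) (ψ z - ψ v) + inner ℝ (ψ x - ψ y) (z - v)

lemma norm_sub_le_add_of_le {F : Type*} [SeminormedAddCommGroup F] {x y : F} {r : ℝ}
    (hx : ‖x‖ ≤ r) (hy : ‖y‖ ≤ r) : ‖x - y‖ ≤ 2 * r :=
  (norm_sub_le x y).trans (by linarith)

lemma abs_inner_le_mul {F : Type*} [NormedAddCommGroup F] [InnerProductSpace ℝ F] {x y : F}
    {r s : ℝ} (hx : ‖x‖ ≤ r) (hy : ‖y‖ ≤ s) : |inner ℝ x y| ≤ r * s :=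
  (abs_real_inner_le_norm x y).trans
    (mul_le_mul hx hy (norm_nonneg _) ((norm_nonneg _).trans hx))

/-- Differences of points near the lattice are, up to the displacement `ψ`, multiples of `N⁻¹`;
so if `⟪x - y, z - v⟫` vanished, then `innerVariation ψ x y z v`, which has absolute value at
most `2 / 5`, would be within `13 * ε` of an integer, and that integer could only be `0`. -/
lemma inner_ne_zero_of_mem_nearLattice {n N : ℕ}
    {ψ : EuclideanSpace ℝ (Fin n) → EuclideanSpace ℝ (Fin n)} {ε : ℝ}
    (hψ : ∀ x, ‖ψ x‖ ≤ 1 / 20) (hε0 : 0 < ε) (hε1 : ε ≤ 1) (hN : 0 < N)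
    (hNε : 1 ≤ ε * (N : ℝ) ^ 2) {x y z v : EuclideanSpace ℝ (Fin n)}
    (hx : x ∈ nearLattice N ψ ε) (hy : y ∈ nearLattice N ψ ε)
    (hz : z ∈ nearLattice N ψ ε) (hv : v ∈ nearLattice N ψ ε)
    (hx1 : ‖x‖ ≤ 1) (hy1 : ‖y‖ ≤ 1) (hz1 : ‖z‖ ≤ 1) (hv1 : ‖v‖ ≤ 1)
    (hL : 16 * ε < |innerVariation ψ x y z v|) :
    inner ℝ (x - y) (z - v) ≠ 0 := by
  intro h0
  obtain ⟨a, ha⟩ := hx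
  obtain ⟨b, hb⟩ := hy
  obtain ⟨c, hc⟩ := hz
  obtain ⟨d, hd⟩ := hv
  have hN' : (0 : ℝ) < N := by exact_mod_cast hN
  have hu := norm_sub_le_add_of_le ha hb
  have hw := norm_sub_le_add_of_le hc hd
  have hp := norm_sub_le_add_of_le hx1 hy1
  have hq := norm_sub_le_add_of_le hz1 hv1
  have hΨ₁ := norm_sub_le_add_of_le (hψ x) (hψ y)
  have hΨ₂ := norm_sub_le_add_of_le (hψ z) (hψ v)
  set u := (N : ℝ) ^ 2 • x - ψ x - (N : ℝ) • intVec a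
    - ((N : ℝ) ^ 2 • y - ψ y - (N : ℝ) • intVec b) with hu_def
  set w := (N : ℝ) ^ 2 • z - ψ z - (N : ℝ) • intVec c
    - ((N : ℝ) ^ 2 • v - ψ v - (N : ℝ) • intVec d) with hw_def
  set m : ℤ := ∑ i, (a - b) i * (c - d) i with hm
  have hA : (N : ℝ) • intVec (a - b) = (N : ℝ) ^ 2 • (x - y) - (ψ x - ψ y + u) := by
    rw [hu_def, intVec_sub]; module
  have hC : (N : ℝ) • intVec (c - d) = (N : ℝ) ^ 2 • (z - v) - (ψ z - ψ v + w) := by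
    rw [hw_def, intVec_sub]; module
  have key : (N : ℝ) ^ 2 * m = -(N : ℝ) ^ 2 * (innerVariation ψ x y z v
      + inner ℝ (x - y) w + inner ℝ u (z - v))
      + inner ℝ (ψ x - ψ y + u) (ψ z - ψ v + w) := by
    have h1 : (N : ℝ) ^ 2 * m = inner ℝ ((N : ℝ) • intVec (a - b)) ((N : ℝ) • intVec (c - d)) := by
      rw [real_inner_smul_left, real_inner_smul_right, inner_intVec]; ring
    rw [h1, hA, hC, innerVariation]
    generalize x - y = p at *
    generalize z - v = q at *
    generalize ψ x - ψ y = Ψ₁ at *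
    generalize ψ z - ψ v = Ψ₂ at *
    simp only [inner_sub_left, inner_sub_right, inner_add_left, inner_add_right,
      real_inner_smul_left, real_inner_smul_right, h0]
    ring
  have e1 := abs_inner_le_mul hp hw
  have e2 := abs_inner_le_mul hu hq
  have hs : ‖ψ x - ψ y + u‖ ≤ 1 / 10 + 2 * ε := (norm_add_le _ _).trans (by linarith)
  have ht : ‖ψ z - ψ v + w‖ ≤ 1 / 10 + 2 * ε := (norm_add_le _ _).trans (by linarith)
  have e3 := abs_inner_le_mul hs ht
  have e3' : |inner ℝ (ψ x - ψ y + u) (ψ z - ψ v + w)| ≤ (5 * ε) * (N : ℝ) ^ 2 := by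
    refine e3.trans ?_
    nlinarith
  have eL : |innerVariation ψ x y z v| ≤ 2 / 5 := by
    have f1 := abs_inner_le_mul hp hΨ₂
    have f2 := abs_inner_le_mul hΨ₁ hq
    exact (abs_add_le _ _).trans (by linarith)
  have hN2 : (0 : ℝ) < (N : ℝ) ^ 2 := by positivity
  have hm13 : |(m : ℝ) + innerVariation ψ x y z v| ≤ 13 * ε := by
    have h1 : (m : ℝ) + innerVariation ψ x y z v = -(inner ℝ (x - y) w + inner ℝ u (z - v))
        + inner ℝ (ψ x - ψ y + u) (ψ z - ψ v + w) / (N : ℝ) ^ 2 := by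
      field_simp
      linarith
    have h2 : |inner ℝ (ψ x - ψ y + u) (ψ z - ψ v + w) / (N : ℝ) ^ 2| ≤ 5 * ε := by
      rw [abs_div, abs_of_pos hN2, div_le_iff₀ hN2]; exact e3'
    rw [h1]
    rw [abs_le] at *
    constructor <;> linarith [e1.1, e1.2, e2.1, e2.2, h2.1, h2.2]
  have hm1 : |(m : ℝ)| < 1 := by
    have : |(m : ℝ)| ≤ |(m : ℝ) + innerVariation ψ x y z v| + |innerVariation ψ x y z v| := by
      simpa using abs_sub ((m : ℝ) + innerVariation ψ x y z v) (innerVariation ψ x y z v)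
    linarith
  have hm0 : m = 0 := Int.abs_lt_one_iff.mp (by exact_mod_cast hm1)
  rw [hm0, Int.cast_zero, zero_add] at hm13
  linarith

/-! ### A countable family of displacements -/

/-- The tent function of height `r` centred at `q`, pointing in the direction of the `i`-th
basis vector and scaled down so that it is bounded by `1 / 20` when `r ≤ 1`. -/
noncomputable def tent {n : ℕ} (q : EuclideanSpace ℝ (Fin n)) (r : ℝ) (i : Fin n)
    (x : EuclideanSpace ℝ (Fin n)) : EuclideanSpace ℝ (Fin n) :=
  (1 / 20 * max 0 (r - dist x q)) • EuclideanSpace.single i (1 : ℝ)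

lemma norm_tent_le {n : ℕ} (q : EuclideanSpace ℝ (Fin n)) {r : ℝ} (hr : r ≤ 1) (i : Fin n)
    (x : EuclideanSpace ℝ (Fin n)) : ‖tent q r i x‖ ≤ 1 / 20 := by
  have h0 : 0 ≤ max 0 (r - dist x q) := le_max_left _ _
  have h1 : max 0 (r - dist x q) ≤ 1 := max_le zero_le_one (by linarith [dist_nonneg (x := x) (y := q)])
  rw [tent, norm_smul, PiLp.norm_single, Real.norm_of_nonneg (by positivity)]
  simp only [norm_one]
  linarith

lemma norm_tent_sub_le {n : ℕ} (q : EuclideanSpace ℝ (Fin n)) (r : ℝ) (i : Fin n)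
    (x y : EuclideanSpace ℝ (Fin n)) : ‖tent q r i x - tent q r i y‖ ≤ ‖x - y‖ := by
  rw [tent, tent, ← sub_smul, norm_smul, PiLp.norm_single, norm_one, mul_one,
    Real.norm_eq_abs, ← mul_sub, abs_mul]
  have h1 : |max 0 (r - dist x q) - max 0 (r - dist y q)| ≤ |(r - dist x q) - (r - dist y q)| := by
    simpa using abs_max_sub_max_le_max 0 (r - dist x q) 0 (r - dist y q)
  have h2 : |(r - dist x q) - (r - dist y q)| ≤ ‖x - y‖ := by
    rw [← dist_eq_norm, show (r - dist x q) - (r - dist y q) = dist y q - dist x q by ring,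
      dist_comm x y]
    exact abs_dist_sub_le y x q
  have h3 := abs_nonneg (max 0 (r - dist x q) - max 0 (r - dist y q))
  rw [abs_of_pos (by norm_num : (0 : ℝ) < 1 / 20)]
  linarith

/-- Tents with centres in a dense sequence and heights `1 / (m + 1)` isolate a point from
finitely many others. -/
lemma exists_tent_isolating {X : Type*} [MetricSpace X] {q : ℕ → X} (hq : DenseRange q)
    (p : X) (F : Finset X) (hp : p ∉ F) :
    ∃ j m : ℕ, 0 < max 0 (1 / ((m : ℝ) + 1) - dist p (q j)) ∧
      ∀ x ∈ F, max 0 (1 / ((m : ℝ) + 1) - dist x (q j)) = 0 := by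
  have hopen : (F : Set X)ᶜ ∈ nhds p := F.finite_toSet.isClosed.isOpen_compl.mem_nhds (by simpa)
  obtain ⟨t, ht, hball⟩ := Metric.mem_nhds_iff.mp hopen
  obtain ⟨m, hm⟩ := exists_nat_one_div_lt (half_pos ht)
  obtain ⟨j, hj⟩ := hq.exists_dist_lt p (ε := 1 / ((m : ℝ) + 1)) (by positivity)
  refine ⟨j, m, lt_max_of_lt_right (by linarith), fun x hx => max_eq_left ?_⟩
  have hxt : t ≤ dist x p := by
    by_contra! h
    exact hball (Metric.mem_ball.mpr h) hx
  have := dist_triangle_right x p (q j)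
  linarith

lemma innerVariation_tent {n : ℕ} (q : EuclideanSpace ℝ (Fin n)) (r : ℝ) (i : Fin n)
    (x y z v : EuclideanSpace ℝ (Fin n)) :
    innerVariation (tent q r i) x y z v = 1 / 20 *
      (((max 0 (r - dist z q) - max 0 (r - dist v q)) • (x - y)
        + (max 0 (r - dist x q) - max 0 (r - dist y q)) • (z - v)) i) := by
  simp only [innerVariation, tent, ← sub_smul, real_inner_smul_left, real_inner_smul_right,
    EuclideanSpace.inner_single_left, EuclideanSpace.inner_single_right]
  simp
  ring

/-- As a functional of `ψ`, `innerVariation ψ x y z v` is the vector-valued combination of point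
masses with weights `x - y` at `z`, `-(x - y)` at `v`, `z - v` at `x` and `-(z - v)` at `y`. These
masses never cancel completely, and the tents detect that. -/
lemma exists_innerVariation_ne_zero {n : ℕ} {q : ℕ → EuclideanSpace ℝ (Fin n)}
    (hq : DenseRange q) {x y z v : EuclideanSpace ℝ (Fin n)} (hxy : x ≠ y) (hzv : z ≠ v) :
    ∃ (j m : ℕ) (i : Fin n), innerVariation (tent (q j) (1 / ((m : ℝ) + 1)) i) x y z v ≠ 0 := by
  by_contra! h
  have hp : x - y ≠ 0 := sub_ne_zero.mpr hxy
  have hw : z - v ≠ 0 := sub_ne_zero.mpr hzv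
  have H : ∀ j m : ℕ,
      (max 0 (1 / ((m : ℝ) + 1) - dist z (q j)) - max 0 (1 / ((m : ℝ) + 1) - dist v (q j))) • (x - y)
      + (max 0 (1 / ((m : ℝ) + 1) - dist x (q j)) - max 0 (1 / ((m : ℝ) + 1) - dist y (q j)))
        • (z - v) = 0 := by
    intro j m
    ext i
    have := h j m i
    rw [innerVariation_tent] at this
    simpa using this
  classical
  have Hy (hyz : y ≠ z) (hyv : y ≠ v) : False := by
    obtain ⟨j, m, hpos, hF⟩ := exists_tent_isolating hq y {x, z, v} (by simp [hxy.symm, hyz, hyv])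
    have := H j m
    rw [hF x (by simp), hF z (by simp), hF v (by simp)] at this
    simp only [sub_self, zero_smul, zero_sub, zero_add, smul_eq_zero, neg_eq_zero] at this
    exact this.elim hpos.ne' hw
  by_cases hxz : x = z
  · obtain ⟨j, m, hpos, hF⟩ := exists_tent_isolating hq x {y, v} (by simp [hxy, hxz ▸ hzv])
    have := H j m
    rw [← hxz, hF y (by simp), hF v (by simp), ← smul_add, smul_eq_zero, sub_zero] at this
    have hsum := this.resolve_left hpos.ne'
    by_cases hyv : y = v
    · rw [← hyv, ← two_smul ℝ, smul_eq_zero] at hsum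
      exact hsum.elim two_ne_zero hp
    · exact Hy (hxz ▸ hxy.symm) hyv
  by_cases hxv : x = v
  · obtain ⟨j, m, hpos, hF⟩ := exists_tent_isolating hq x {y, z} (by simp [hxy, hxz])
    have := H j m
    rw [← hxv, hF y (by simp), hF z (by simp), zero_sub, sub_zero, neg_smul, ← smul_neg,
      ← smul_add, smul_eq_zero] at this
    have hsum := this.resolve_left hpos.ne'
    by_cases hyz : y = z
    · rw [← hyz, neg_sub, ← two_smul ℝ, smul_eq_zero, sub_eq_zero] at hsum
      exact hsum.elim two_ne_zero hxy.symm
    · exact Hy hyz (hxv ▸ hxy.symm)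
  obtain ⟨j, m, hpos, hF⟩ := exists_tent_isolating hq x {y, z, v} (by simp [hxy, hxz, hxv])
  have := H j m
  rw [hF y (by simp), hF z (by simp), hF v (by simp)] at this
  simp only [sub_self, zero_smul, sub_zero, zero_add, smul_eq_zero] at this
  exact this.elim hpos.ne' hw

/-- A sequence of displacements `ψ k` and tolerances `ε k` such that every admissible quadruple
is moved by some `ψ k` to an extent that is visible at tolerance `ε k`. -/
lemma exists_displacements {n : ℕ} (hn : 0 < n) :
    ∃ (ψ : ℕ → EuclideanSpace ℝ (Fin n) → EuclideanSpace ℝ (Fin n)) (ε : ℕ → ℝ),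
      (∀ k x, ‖ψ k x‖ ≤ 1 / 20) ∧ (∀ k x y, ‖ψ k x - ψ k y‖ ≤ ‖x - y‖) ∧
      (∀ k, 0 < ε k) ∧ (∀ k, ε k ≤ 1) ∧
      ∀ x y z v, x ≠ y → z ≠ v → ∃ k, 16 * ε k < |innerVariation (ψ k) x y z v| := by
  have : Nonempty (Fin n) := ⟨⟨0, hn⟩⟩
  obtain ⟨e, he⟩ := exists_surjective_nat ((ℕ × ℕ) × Fin n × ℕ)
  have hle : ∀ m : ℕ, 1 / ((m : ℝ) + 1) ≤ 1 := fun m => by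
    rw [div_le_one (by positivity)]; linarith [m.cast_nonneg (α := ℝ)]
  refine ⟨fun k => tent (TopologicalSpace.denseSeq _ (e k).1.1) (1 / (((e k).1.2 : ℝ) + 1))
    (e k).2.1, fun k => 1 / (((e k).2.2 : ℝ) + 1), fun k x => norm_tent_le _ (hle _) _ _,
    fun k x y => norm_tent_sub_le _ _ _ _ _, fun k => by positivity, fun k => hle _, ?_⟩
  intro x y z v hxy hzv
  obtain ⟨j, m, i, h⟩ := exists_innerVariation_ne_zero
    (TopologicalSpace.denseRange_denseSeq (EuclideanSpace ℝ (Fin n))) hxy hzv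
  obtain ⟨m', hm'⟩ := exists_nat_one_div_lt (div_pos (abs_pos.mpr h) (by norm_num : (0 : ℝ) < 16))
  obtain ⟨k, hk⟩ := he ((j, m), i, m')
  refine ⟨k, ?_⟩
  simp only [hk]
  linarith

/-! ### Covers by lattice cells -/

/-- The part of `nearLattice N ψ ε` that belongs to the lattice point `a / N`. -/
def latticeCell {n : ℕ} (N : ℕ) (ψ : EuclideanSpace ℝ (Fin n) → EuclideanSpace ℝ (Fin n))
    (ε : ℝ) (a : Fin n → ℤ) : Set (EuclideanSpace ℝ (Fin n)) :=
  {x | ‖(N : ℝ) ^ 2 • x - ψ x - (N : ℝ) • intVec a‖ ≤ ε}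

/-- The indices of the lattice cells that can meet the closed unit ball. -/
noncomputable def cellIndices (n N : ℕ) : Finset (Fin n → ℤ) :=
  Fintype.piFinset fun _ => Finset.Icc (-(3 * N : ℤ)) (3 * N)

lemma card_cellIndices (n N : ℕ) : (cellIndices n N).card = (6 * N + 1) ^ n := by
  simp only [cellIndices, Fintype.card_piFinset, Int.card_Icc, Finset.prod_const, Finset.card_univ,
    Fintype.card_fin]
  congr 1
  omega

lemma isClosed_latticeCell {n N : ℕ} {ψ : EuclideanSpace ℝ (Fin n) → EuclideanSpace ℝ (Fin n)}
    (hψ : Continuous ψ) (ε : ℝ) (a : Fin n → ℤ) : IsClosed (latticeCell N ψ ε a) :=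
  isClosed_le (by fun_prop) continuous_const

lemma nearLattice_inter_closedBall {n N : ℕ}
    {ψ : EuclideanSpace ℝ (Fin n) → EuclideanSpace ℝ (Fin n)} (hψ : ∀ x, ‖ψ x‖ ≤ 1 / 20)
    {ε : ℝ} (hε1 : ε ≤ 1) (hN : 0 < N) :
    nearLattice N ψ ε ∩ Metric.closedBall 0 1
      = (⋃ a ∈ cellIndices n N, latticeCell N ψ ε a) ∩ Metric.closedBall 0 1 := by
  ext x
  simp only [Set.mem_inter_iff, Set.mem_iUnion, exists_prop, mem_closedBall_zero_iff]
  refine ⟨fun ⟨⟨a, ha⟩, hx⟩ => ⟨⟨a, ?_, ha⟩, hx⟩, fun ⟨⟨a, _, ha⟩, hx⟩ => ⟨⟨a, ha⟩, hx⟩⟩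
  have hN' : (1 : ℝ) ≤ N := by exact_mod_cast hN
  rw [cellIndices, Fintype.mem_piFinset]
  intro i
  have h1 : ‖(N : ℝ) • intVec a‖ ≤ (N : ℝ) ^ 2 + 2 := by
    have h2 : (N : ℝ) • intVec a = (N : ℝ) ^ 2 • x - ψ x - ((N : ℝ) ^ 2 • x - ψ x
      - (N : ℝ) • intVec a) := by abel
    rw [h2]
    refine (norm_sub_le _ _).trans ?_
    have h3 : ‖(N : ℝ) ^ 2 • x‖ ≤ (N : ℝ) ^ 2 := by
      rw [norm_smul, Real.norm_of_nonneg (by positivity)]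
      exact mul_le_of_le_one_right (by positivity) hx
    linarith [norm_sub_le ((N : ℝ) ^ 2 • x) (ψ x), hψ x]
  have h4 : (N : ℝ) * |(a i : ℝ)| ≤ (N : ℝ) * (3 * N) := by
    have h5 := PiLp.norm_apply_le ((N : ℝ) • intVec a) i
    rw [PiLp.smul_apply, intVec_apply, smul_eq_mul, norm_mul, Real.norm_natCast,
      Real.norm_eq_abs] at h5
    nlinarith
  have h6 := le_of_mul_le_mul_left h4 (by linarith)
  have h7 : |a i| ≤ 3 * N := by exact_mod_cast h6
  exact Finset.mem_Icc.mpr (abs_le.mp h7)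

lemma isClosed_nearLattice_inter_closedBall {n N : ℕ}
    {ψ : EuclideanSpace ℝ (Fin n) → EuclideanSpace ℝ (Fin n)} (hψ : ∀ x, ‖ψ x‖ ≤ 1 / 20)
    (hψc : Continuous ψ) {ε : ℝ} (hε1 : ε ≤ 1) (hN : 0 < N) :
    IsClosed (nearLattice N ψ ε ∩ Metric.closedBall 0 1) := by
  rw [nearLattice_inter_closedBall hψ hε1 hN]
  exact ((cellIndices n N).finite_toSet.isClosed_biUnion fun a _ =>
    isClosed_latticeCell hψc ε a).inter Metric.isClosed_closedBall

lemma ediam_latticeCell_le {n N : ℕ}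
    {ψ : EuclideanSpace ℝ (Fin n) → EuclideanSpace ℝ (Fin n)} (hψ : ∀ x, ‖ψ x‖ ≤ 1 / 20)
    {ε : ℝ} (hε1 : ε ≤ 1) (hN : 0 < N) (a : Fin n → ℤ) :
    Metric.ediam (latticeCell N ψ ε a) ≤ ENNReal.ofReal ((2 / N) ^ 2) := by
  have hN' : (0 : ℝ) < (N : ℝ) := by exact_mod_cast hN
  refine Metric.ediam_le fun x hx y hy => ?_
  rw [edist_dist]
  refine ENNReal.ofReal_le_ofReal ?_
  rw [dist_eq_norm, div_pow, le_div_iff₀ (by positivity)]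
  have h1 : (N : ℝ) ^ 2 • (x - y) = ((N : ℝ) ^ 2 • x - ψ x - (N : ℝ) • intVec a)
      - ((N : ℝ) ^ 2 • y - ψ y - (N : ℝ) • intVec a) + (ψ x - ψ y) := by module
  have h2 : ‖(N : ℝ) ^ 2 • (x - y)‖ ≤ 2 * ε + 2 * (1 / 20) := by
    rw [h1]
    exact (norm_add_le _ _).trans (add_le_add (norm_sub_le_add_of_le hx hy)
      (norm_sub_le_add_of_le (hψ x) (hψ y)))
  rw [norm_smul, Real.norm_of_nonneg (by positivity)] at h2
  linarith

open MeasureTheory Filter Topology in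
/-- A set that lies near infinitely many of the lattices is covered by `O(N ^ n)` cells of diameter
`O(N ^ (-2))`, for arbitrarily large `N`. -/
lemma dimH_le_of_subset_nearLattice {n : ℕ}
    {ψ : ℕ → EuclideanSpace ℝ (Fin n) → EuclideanSpace ℝ (Fin n)}
    (hψ : ∀ k x, ‖ψ k x‖ ≤ 1 / 20) {ε : ℕ → ℝ} (hε1 : ∀ k, ε k ≤ 1) {N : ℕ → ℕ}
    (hN : ∀ k, 0 < N k) (hNlim : Tendsto N atTop atTop) {E : Set (EuclideanSpace ℝ (Fin n))}
    (hE : ∀ k, E ⊆ nearLattice (N k) (ψ k) (ε k) ∩ Metric.closedBall 0 1) :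
    dimH E ≤ (n : ENNReal) / 2 := by
  borelize (EuclideanSpace ℝ (Fin n))
  have hcast : (((n : NNReal) / 2 : NNReal) : ENNReal) = (n : ENNReal) / 2 := by
    rw [ENNReal.coe_div two_ne_zero]; simp
  rw [← hcast]
  refine dimH_le_of_hausdorffMeasure_ne_top (ne_top_of_le_ne_top (b := ENNReal.ofReal (14 ^ n))
    ENNReal.ofReal_ne_top ?_)
  have hr : Tendsto (fun k => ENNReal.ofReal ((2 / (N k : ℝ)) ^ 2)) atTop (𝓝 0) := by
    have h1 : Tendsto (fun k => (2 / (N k : ℝ)) ^ 2) atTop (𝓝 0) := by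
      simpa using ((tendsto_const_div_atTop_nhds_zero_nat (2 : ℝ)).comp hNlim).pow 2
    simpa using ENNReal.tendsto_ofReal h1
  refine (Measure.hausdorffMeasure_le_liminf_sum (ι := fun k => cellIndices n (N k))
    _ E _ hr (fun k a => latticeCell (N k) (ψ k) (ε k) a)
    (Eventually.of_forall fun k a => ediam_latticeCell_le (hψ k) (hε1 k) (hN k) a)
    (Eventually.of_forall fun k x hx => ?_)).trans ?_
  · have h := hE k hx
    rw [nearLattice_inter_closedBall (hψ k) (hε1 k) (hN k)] at h
    obtain ⟨a, ha, hxa⟩ := Set.mem_iUnion₂.mp h.1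
    exact Set.mem_iUnion.mpr ⟨⟨a, ha⟩, hxa⟩
  · refine liminf_le_of_le (by isBoundedDefault) fun b hb => ?_
    obtain ⟨k, hk⟩ := hb.exists
    refine hk.trans ?_
    have hNk : (0 : ℝ) < N k := by exact_mod_cast hN k
    have hNk1 : (1 : ℝ) ≤ N k := by exact_mod_cast hN k
    calc ∑ a : cellIndices n (N k), Metric.ediam (latticeCell (N k) (ψ k) (ε k) a)
            ^ (((n : NNReal) / 2 : NNReal) : ℝ)
        ≤ ∑ _a : cellIndices n (N k), ENNReal.ofReal ((2 / (N k : ℝ)) ^ n) := by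
          refine Finset.sum_le_sum fun a _ => ?_
          refine (ENNReal.rpow_le_rpow (ediam_latticeCell_le (hψ k) (hε1 k) (hN k) a)
            NNReal.zero_le_coe).trans_eq ?_
          rw [ENNReal.ofReal_rpow_of_pos (by positivity), ← Real.rpow_natCast _ 2,
            ← Real.rpow_mul (by positivity), ← Real.rpow_natCast _ n]
          congr 2
          push_cast
          ring
      _ = ENNReal.ofReal ((6 * N k + 1) ^ n * (2 / (N k : ℝ)) ^ n) := by
          rw [Finset.sum_const, Finset.card_univ, Fintype.card_coe, card_cellIndices,
            nsmul_eq_mul, ENNReal.ofReal_mul (by positivity)]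
          congr 1
          rw [← ENNReal.ofReal_natCast]
          push_cast
          rfl
      _ ≤ ENNReal.ofReal (14 ^ n) := by
          refine ENNReal.ofReal_le_ofReal ?_
          rw [← mul_pow]
          refine pow_le_pow_left₀ (by positivity) ?_ n
          rw [mul_div_assoc', div_le_iff₀ hNk]
          linarith

/-! ### Scales of a homogeneous Cantor construction -/

/-- Scales for a Cantor construction in `ℝⁿ` with tolerances `ε k`. At step `k` a ball of radius
`δ k` receives, in each coordinate direction, `M k` consecutive points of (a perturbation of)
`(N k)⁻¹ ℤ`, each of which becomes the centre of a ball of radius `δ (k + 1) = ε k / (4 * N k ^ 2)`;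
`P k` is the product of the earlier branching numbers. The field `growth` says that the
`P (k + 1) ^ n` balls of radius `δ (k + 1)` are numerous enough for dimension
`n * (1 / 2 - 1 / (k + 3))`. -/
structure CantorScale (n : ℕ) (ε : ℕ → ℝ) where
  N : ℕ → ℕ
  M : ℕ → ℕ
  P : ℕ → ℕ
  δ : ℕ → ℝ
  P_zero : P 0 = 1
  δ_zero : δ 0 = 1
  P_succ : ∀ k, P (k + 1) = P k * M k
  δ_succ : ∀ k, δ (k + 1) = ε k / (4 * (N k : ℝ) ^ 2)
  two_le_M : ∀ k, 2 ≤ M k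
  six_le_N : ∀ k, 6 ≤ N k
  le_N : ∀ k, k ≤ N k
  four_le : ∀ k, 4 ≤ ε k * N k
  eight_le : ∀ k, 8 * (n : ℝ) ≤ δ k * N k
  M_le : ∀ k, 4 * (n : ℝ) * M k ≤ δ k * N k
  le_M : ∀ k, δ k * N k ≤ 8 * n * M k
  growth : ∀ k : ℕ, 1 ≤ P (k + 1) * δ (k + 1) ^ ((1 : ℝ) / 2 - 1 / ((k : ℝ) + 3))

open Filter in
/-- The growth condition can be met because `N * (N ^ 2) ^ (-s)` tends to infinity for
`s < 1 / 2`. -/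
lemma exists_cantorScale_step {n : ℕ} (hn : 0 < n) {ε : ℝ} (hε : 0 < ε) (k P : ℕ) (hP : 0 < P)
    {δ : ℝ} (hδ : 0 < δ) :
    ∃ N M : ℕ, 2 ≤ M ∧ 6 ≤ N ∧ k ≤ N ∧ 4 ≤ ε * N ∧ 8 * (n : ℝ) ≤ δ * N ∧
      4 * (n : ℝ) * M ≤ δ * N ∧ δ * N ≤ 8 * n * M ∧
      1 ≤ ((P * M : ℕ) : ℝ)
        * (ε / (4 * (N : ℝ) ^ 2)) ^ ((1 : ℝ) / 2 - 1 / ((k : ℝ) + 3)) := by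
  set s : ℝ := (1 : ℝ) / 2 - 1 / ((k : ℝ) + 3) with hs
  have hn' : (0 : ℝ) < n := by exact_mod_cast hn
  have hP' : (0 : ℝ) < P := by exact_mod_cast hP
  have hs1 : 0 < 1 - 2 * s := by
    have : 1 - 2 * s = 2 / ((k : ℝ) + 3) := by rw [hs]; ring
    rw [this]; positivity
  set K : ℝ := P * δ * (ε / 4) ^ s / (8 * n) with hK
  have hKpos : 0 < K := by positivity
  have t1 : Tendsto (fun N : ℕ => ε * (N : ℝ)) atTop atTop :=
    tendsto_natCast_atTop_atTop.const_mul_atTop hε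
  have t2 : Tendsto (fun N : ℕ => δ * (N : ℝ)) atTop atTop :=
    tendsto_natCast_atTop_atTop.const_mul_atTop hδ
  have t3 : Tendsto (fun N : ℕ => K * (N : ℝ) ^ (1 - 2 * s)) atTop atTop :=
    ((tendsto_rpow_atTop hs1).comp tendsto_natCast_atTop_atTop).const_mul_atTop hKpos
  obtain ⟨N, h1, h2, h3, h6, hk⟩ := ((t1.eventually_ge_atTop 4).and
    ((t2.eventually_ge_atTop (8 * n)).and ((t3.eventually_ge_atTop 1).and
      ((eventually_ge_atTop 6).and (eventually_ge_atTop k))))).exists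
  have hN' : (0 : ℝ) < N := by exact_mod_cast (show 0 < N by omega)
  set t : ℝ := δ * N / (4 * n) with ht
  have ht2 : 2 ≤ t := by rw [ht, le_div_iff₀ (by positivity)]; linarith
  have hfl : (⌊t⌋₊ : ℝ) ≤ t := Nat.floor_le (by linarith)
  have hfl' : t < ⌊t⌋₊ + 1 := Nat.lt_floor_add_one t
  have htn : 4 * n * t = δ * N := by rw [ht]; field_simp
  have hM2 : 2 ≤ ⌊t⌋₊ := Nat.le_floor (by exact_mod_cast ht2)
  have hleM : δ * N ≤ 8 * n * ⌊t⌋₊ := by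
    have : t ≤ 2 * ⌊t⌋₊ := by linarith
    nlinarith
  refine ⟨N, ⌊t⌋₊, hM2, h6, hk, h1, h2, ?_, hleM, ?_⟩
  · rw [← htn]; gcongr
  · refine h3.trans ?_
    have e1 : (ε / (4 * (N : ℝ) ^ 2)) ^ s = (ε / 4) ^ s * (N : ℝ) ^ (-(2 * s)) := by
      rw [← div_div, Real.div_rpow (by positivity) (by positivity), ← Real.rpow_natCast,
        ← Real.rpow_mul hN'.le, Real.rpow_neg hN'.le]
      push_cast
      rfl
    have e2 : (N : ℝ) ^ (1 - 2 * s) = N * (N : ℝ) ^ (-(2 * s)) := by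
      rw [sub_eq_add_neg, Real.rpow_add hN', Real.rpow_one]
    rw [e1, e2, hK]
    push_cast
    have e3 : P * δ * (ε / 4) ^ s / (8 * n) * (N * (N : ℝ) ^ (-(2 * s)))
        = P * (δ * N / (8 * n)) * ((ε / 4) ^ s * (N : ℝ) ^ (-(2 * s))) := by ring
    rw [e3]
    have e4 : δ * N / (8 * n) ≤ ⌊t⌋₊ := by
      rw [div_le_iff₀ (by positivity)]; linarith
    gcongr

lemma exists_cantorScale {n : ℕ} (hn : 0 < n) {ε : ℕ → ℝ} (hε : ∀ k, 0 < ε k) :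
    Nonempty (CantorScale n ε) := by
  have H : ∀ (k P : ℕ) (δ : ℝ), 0 < P ∧ 0 < δ → ∃ N M : ℕ, 2 ≤ M ∧ 6 ≤ N ∧ k ≤ N ∧
      4 ≤ ε k * N ∧ 8 * (n : ℝ) ≤ δ * N ∧ 4 * (n : ℝ) * M ≤ δ * N ∧ δ * N ≤ 8 * n * M ∧
      1 ≤ ((P * M : ℕ) : ℝ)
        * (ε k / (4 * (N : ℝ) ^ 2)) ^ ((1 : ℝ) / 2 - 1 / ((k : ℝ) + 3)) :=
    fun k P δ h => exists_cantorScale_step hn (hε k) k P h.1 h.2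
  choose! N M h using H
  let st : ℕ → ℕ × ℝ := fun k => Nat.rec (1, 1)
    (fun k p => (p.1 * M k p.1 p.2, ε k / (4 * (N k p.1 p.2 : ℝ) ^ 2))) k
  have hst : ∀ k, 0 < (st k).1 ∧ 0 < (st k).2 := by
    intro k
    induction k with
    | zero => exact ⟨one_pos, one_pos⟩
    | succ k ih =>
      have h' := h k _ _ ih
      have hN : (0 : ℝ) < N k (st k).1 (st k).2 := by
        exact_mod_cast (show 0 < N k (st k).1 (st k).2 by omega)
      exact ⟨Nat.mul_pos ih.1 (lt_of_lt_of_le two_pos h'.1), div_pos (hε k) (by positivity)⟩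
  have h' := fun k => h k _ _ (hst k)
  exact ⟨{
    N := fun k => N k (st k).1 (st k).2
    M := fun k => M k (st k).1 (st k).2
    P := fun k => (st k).1
    δ := fun k => (st k).2
    P_zero := rfl
    δ_zero := rfl
    P_succ := fun _ => rfl
    δ_succ := fun _ => rfl
    two_le_M := fun k => (h' k).1
    six_le_N := fun k => (h' k).2.1
    le_N := fun k => (h' k).2.2.1
    four_le := fun k => (h' k).2.2.2.1
    eight_le := fun k => (h' k).2.2.2.2.1
    M_le := fun k => (h' k).2.2.2.2.2.1
    le_M := fun k => (h' k).2.2.2.2.2.2.1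
    growth := fun k => (h' k).2.2.2.2.2.2.2 }⟩

namespace CantorScale

variable {n : ℕ} {ε : ℕ → ℝ} (S : CantorScale n ε)

lemma N_pos (k : ℕ) : 0 < S.N k := by have := S.six_le_N k; omega

lemma P_pos (k : ℕ) : 0 < S.P k := by
  induction k with
  | zero => simp [S.P_zero]
  | succ k ih => rw [S.P_succ]; exact Nat.mul_pos ih (by have := S.two_le_M k; omega)

lemma lt_P (k : ℕ) : k < S.P k := by
  induction k with
  | zero => exact S.P_pos 0
  | succ k ih => rw [S.P_succ]; nlinarith [S.two_le_M k]

lemma δ_pos (hε : ∀ k, 0 < ε k) : ∀ k, 0 < S.δ k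
  | 0 => by rw [S.δ_zero]; exact one_pos
  | k + 1 => by
    have := S.N_pos k
    rw [S.δ_succ]; exact div_pos (hε k) (by positivity)

lemma δ_succ_le (hε1 : ∀ k, ε k ≤ 1) (k : ℕ) : S.δ (k + 1) ≤ 1 / (4 * (S.N k : ℝ) ^ 2) := by
  rw [S.δ_succ]
  exact div_le_div_of_nonneg_right (hε1 k) (by positivity)

lemma δ_le_one (hε1 : ∀ k, ε k ≤ 1) : ∀ k, S.δ k ≤ 1
  | 0 => S.δ_zero.le
  | k + 1 => by
    refine (S.δ_succ_le hε1 k).trans ?_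
    have : (1 : ℝ) ≤ S.N k := by exact_mod_cast S.N_pos k
    rw [div_le_one (by positivity)]
    nlinarith

lemma one_div_N_sq_le (hn : 0 < n) (k : ℕ) : 1 / (S.N k : ℝ) ^ 2 ≤ S.δ k / 8 := by
  have hn' : (1 : ℝ) ≤ n := by exact_mod_cast hn
  have hN : (1 : ℝ) ≤ S.N k := by exact_mod_cast S.N_pos k
  have h := S.eight_le k
  rw [div_le_iff₀ (by positivity)]
  nlinarith

lemma four_le_N_sq (k : ℕ) : 4 ≤ ε k * (S.N k : ℝ) ^ 2 := by
  have hN : (1 : ℝ) ≤ S.N k := by exact_mod_cast S.N_pos k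
  nlinarith [S.four_le k]

/-! ### Embedding the cube into the Cantor set -/

/-- The `k`-th digit of `x` (in each coordinate) in the mixed-radix expansion with radices `M`. -/
noncomputable def digit (k : ℕ) (x : Fin n → ℝ) (i : Fin n) : ℤ :=
  ⌊S.P (k + 1) * x i⌋ - S.M k * ⌊S.P k * x i⌋

lemma digit_nonneg (k : ℕ) (x : Fin n → ℝ) (i : Fin n) : 0 ≤ S.digit k x i := by
  rw [digit, sub_nonneg, Int.le_floor, S.P_succ]
  push_cast
  have := mul_le_mul_of_nonneg_left (Int.floor_le (S.P k * x i)) (Nat.cast_nonneg (α := ℝ) (S.M k))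
  linarith

lemma digit_lt (k : ℕ) (x : Fin n → ℝ) (i : Fin n) : S.digit k x i < S.M k := by
  rw [digit, sub_lt_iff_lt_add, Int.floor_lt, S.P_succ]
  push_cast
  have hM : (0 : ℝ) < S.M k := by exact_mod_cast (show 0 < S.M k by have := S.two_le_M k; omega)
  have := mul_lt_mul_of_pos_left (Int.lt_floor_add_one (S.P k * x i)) hM
  linarith

/-- The integer vector `N k • a`, where `a` is the lattice point selected near `c` by the `k`-th
digits of `x`. -/
noncomputable def latticeIndex (x : Fin n → ℝ) (k : ℕ) (c : EuclideanSpace ℝ (Fin n)) :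
    Fin n → ℤ :=
  fun i => ⌊S.N k * c i⌋ + S.digit k x i

/-- The lattice point in `(N k)⁻¹ ℤⁿ` selected near `c` by the `k`-th digits of `x`. -/
noncomputable def latticePoint (x : Fin n → ℝ) (k : ℕ) (c : EuclideanSpace ℝ (Fin n)) :
    EuclideanSpace ℝ (Fin n) :=
  (S.N k : ℝ)⁻¹ • intVec (S.latticeIndex x k c)

variable (ψ : ℕ → EuclideanSpace ℝ (Fin n) → EuclideanSpace ℝ (Fin n))

/-- The centre of the `k`-th ball of the Cantor construction along the branch given by the
digits of `x`. -/
noncomputable def center (x : Fin n → ℝ) : ℕ → EuclideanSpace ℝ (Fin n)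
  | 0 => 0
  | k + 1 => S.latticePoint x k (center x k)
      + ((S.N k : ℝ) ^ 2)⁻¹ • ψ k (S.latticePoint x k (center x k))

lemma norm_latticePoint_sub_le (x : Fin n → ℝ) (k : ℕ) (c : EuclideanSpace ℝ (Fin n)) :
    ‖S.latticePoint x k c - c‖ ≤ S.δ k / 4 := by
  have hN : (0 : ℝ) < S.N k := by exact_mod_cast S.N_pos k
  have hcoord : ∀ i, ‖(S.latticePoint x k c - c) i‖ ≤ S.M k / S.N k := by
    intro i
    have h1 : (S.latticePoint x k c - c) i
        = ((⌊S.N k * c i⌋ : ℝ) + S.digit k x i - S.N k * c i) / S.N k := by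
      simp only [latticePoint, latticeIndex, PiLp.sub_apply, PiLp.smul_apply, intVec_apply,
        smul_eq_mul]
      push_cast
      field_simp
    rw [h1, norm_div, Real.norm_natCast]
    refine div_le_div_of_nonneg_right ?_ hN.le
    have h2 : (0 : ℝ) ≤ S.digit k x i := by exact_mod_cast S.digit_nonneg k x i
    have h3 : (S.digit k x i : ℝ) + 1 ≤ S.M k := by exact_mod_cast S.digit_lt k x i
    have h4 := Int.floor_le (S.N k * c i)
    have h5 := Int.lt_floor_add_one (S.N k * c i)
    rw [Real.norm_eq_abs, abs_le]
    constructor <;> linarith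
  calc ‖S.latticePoint x k c - c‖ ≤ ∑ i, ‖(S.latticePoint x k c - c) i‖ := by
        rw [EuclideanSpace.norm_eq]
        refine Real.sqrt_le_iff.mpr ⟨by positivity, ?_⟩
        exact Finset.sum_sq_le_sq_sum_of_nonneg fun i _ => norm_nonneg _
    _ ≤ ∑ _i : Fin n, (S.M k : ℝ) / S.N k := Finset.sum_le_sum fun i _ => hcoord i
    _ = n * S.M k / S.N k := by simp [mul_div_assoc]
    _ ≤ S.δ k / 4 := by
        rw [div_le_iff₀ hN]
        linarith [S.M_le k]

variable {ψ}

lemma closedBall_center_succ_subset (hn : 0 < n) (hε1 : ∀ k, ε k ≤ 1)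
    (hψ : ∀ k x, ‖ψ k x‖ ≤ 1 / 20) (x : Fin n → ℝ) (k : ℕ) :
    Metric.closedBall (S.center ψ x (k + 1)) (S.δ (k + 1))
      ⊆ Metric.closedBall (S.center ψ x k) (S.δ k) := by
  refine Metric.closedBall_subset_closedBall' ?_
  have h1 := S.norm_latticePoint_sub_le x k (S.center ψ x k)
  have h2 := S.one_div_N_sq_le hn k
  have h3 : S.δ (k + 1) ≤ 1 / (S.N k : ℝ) ^ 2 / 4 := by
    refine (S.δ_succ_le hε1 k).trans_eq ?_
    rw [div_div, mul_comm]
  have h4 : ‖((S.N k : ℝ) ^ 2)⁻¹ • ψ k (S.latticePoint x k (S.center ψ x k))‖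
      ≤ 1 / (S.N k : ℝ) ^ 2 := by
    rw [norm_smul, Real.norm_of_nonneg (by positivity), one_div]
    exact mul_le_of_le_one_right (by positivity) ((hψ _ _).trans (by norm_num))
  have h5 : dist (S.center ψ x (k + 1)) (S.center ψ x k) ≤ S.δ k / 4 + 1 / (S.N k : ℝ) ^ 2 := by
    rw [dist_eq_norm, center, add_sub_right_comm]
    exact (norm_add_le _ _).trans (add_le_add h1 h4)
  have h6 : 0 < 1 / (S.N k : ℝ) ^ 2 := by
    have := S.N_pos k
    positivity
  linarith

lemma exists_mem_closedBall_center (hn : 0 < n) (hε : ∀ k, 0 < ε k) (hε1 : ∀ k, ε k ≤ 1)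
    (hψ : ∀ k x, ‖ψ k x‖ ≤ 1 / 20) (x : Fin n → ℝ) :
    ∃ p, ∀ k, p ∈ Metric.closedBall (S.center ψ x k) (S.δ k) := by
  obtain ⟨p, hp⟩ := IsCompact.nonempty_iInter_of_sequence_nonempty_isCompact_isClosed
    (fun k => Metric.closedBall (S.center ψ x k) (S.δ k))
    (S.closedBall_center_succ_subset hn hε1 hψ x)
    (fun k => Metric.nonempty_closedBall.mpr (S.δ_pos hε k).le)
    (isCompact_closedBall _ _) (fun k => Metric.isClosed_closedBall)
  exact ⟨p, Set.mem_iInter.mp hp⟩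

lemma mem_nearLattice_of_mem_closedBall_center
    (hψL : ∀ k x y, ‖ψ k x - ψ k y‖ ≤ ‖x - y‖) (hψ : ∀ k x, ‖ψ k x‖ ≤ 1 / 20)
    {x : Fin n → ℝ} {k : ℕ} {p : EuclideanSpace ℝ (Fin n)}
    (hp : p ∈ Metric.closedBall (S.center ψ x (k + 1)) (S.δ (k + 1))) :
    p ∈ nearLattice (S.N k) (ψ k) (ε k) := by
  have hN : (1 : ℝ) ≤ S.N k := by exact_mod_cast S.N_pos k
  have hN2 : (1 : ℝ) ≤ (S.N k : ℝ) ^ 2 := one_le_pow₀ hN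
  refine ⟨S.latticeIndex x k (S.center ψ x k), ?_⟩
  rw [mem_closedBall_iff_norm] at hp
  set c := S.center ψ x (k + 1) with hc
  set a := S.latticePoint x k (S.center ψ x k) with ha
  have hca : c = a + ((S.N k : ℝ) ^ 2)⁻¹ • ψ k a := by rw [hc, center]
  have haN : (S.N k : ℝ) • intVec (S.latticeIndex x k (S.center ψ x k)) = (S.N k : ℝ) ^ 2 • a := by
    rw [ha, latticePoint, smul_smul]
    congr 1
    field_simp
  have hca' : (S.N k : ℝ) ^ 2 • c = (S.N k : ℝ) ^ 2 • a + ψ k a := by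
    rw [hca, smul_add, smul_inv_smul₀ (by positivity)]
  have hca2 : ‖c - a‖ * (S.N k : ℝ) ^ 2 ≤ 1 / 20 := by
    rw [hca, add_sub_cancel_left, norm_smul, Real.norm_of_nonneg (by positivity), mul_comm,
      ← mul_assoc, mul_inv_cancel₀ (by positivity), one_mul]
    exact hψ _ _
  have h1 : (S.N k : ℝ) ^ 2 • p - ψ k p
      - (S.N k : ℝ) • intVec (S.latticeIndex x k (S.center ψ x k))
      = (S.N k : ℝ) ^ 2 • (p - c) + (ψ k a - ψ k p) := by
    rw [haN, smul_sub, hca']; abel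
  have h2 : ‖ψ k a - ψ k p‖ ≤ ‖c - a‖ + ‖p - c‖ := by
    refine (hψL k a p).trans ?_
    rw [norm_sub_rev, add_comm]
    exact norm_sub_le_norm_sub_add_norm_sub p c a
  have h3 : (S.N k : ℝ) ^ 2 * S.δ (k + 1) = ε k / 4 := by
    rw [S.δ_succ]; field_simp
  have h4 : ‖(S.N k : ℝ) ^ 2 • (p - c)‖ ≤ ε k / 4 := by
    rw [norm_smul, Real.norm_of_nonneg (by positivity), ← h3]
    gcongr
  have h5 : ‖c - a‖ ≤ ε k / 4 := by
    have := S.four_le_N_sq k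
    nlinarith [norm_nonneg (c - a)]
  have h6 : ‖p - c‖ ≤ ε k / 4 := by
    rw [← h3]
    nlinarith [norm_nonneg (p - c)]
  rw [h1]
  refine (norm_add_le _ _).trans ?_
  have h7 : 0 ≤ ε k := by linarith [norm_nonneg (p - c)]
  linarith

lemma center_eq_of_floor_eq {x y : Fin n → ℝ} :
    ∀ {k : ℕ}, (∀ j ≤ k, ∀ i, ⌊S.P j * x i⌋ = ⌊S.P j * y i⌋) → S.center ψ x k = S.center ψ y k
  | 0, _ => rfl
  | k + 1, h => by
    have ih := center_eq_of_floor_eq (k := k) fun j hj => h j (by omega)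
    have hd : S.digit k x = S.digit k y := by
      ext i
      rw [digit, digit, h (k + 1) le_rfl i, h k (by omega) i]
    simp only [center, latticePoint, show S.latticeIndex x k = S.latticeIndex y k by
      ext c i; simp only [latticeIndex, hd], ih]

/-- Points of one ball whose next digits differ by `j` in some coordinate are at distance at least
`j / (2 * N k)`: neither the displacement by `ψ k` nor the later steps, which move points by
`O(N k ^ (-2))`, can undo the spacing `1 / N k` of the lattice. -/
lemma abs_digit_sub_le (hε1 : ∀ k, ε k ≤ 1)
    (hψ : ∀ k x, ‖ψ k x‖ ≤ 1 / 20) {x y : Fin n → ℝ} {k : ℕ}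
    (hk : ∀ j ≤ k, ∀ i, ⌊S.P j * x i⌋ = ⌊S.P j * y i⌋)
    {p q : EuclideanSpace ℝ (Fin n)}
    (hp : p ∈ Metric.closedBall (S.center ψ x (k + 1)) (S.δ (k + 1)))
    (hq : q ∈ Metric.closedBall (S.center ψ y (k + 1)) (S.δ (k + 1)))
    {i : Fin n} (hi : S.digit k x i ≠ S.digit k y i) :
    |(S.digit k x i : ℝ) - S.digit k y i| ≤ 2 * S.N k * ‖p - q‖ := by
  have hN : (6 : ℝ) ≤ S.N k := by exact_mod_cast S.six_le_N k
  have hN0 : (0 : ℝ) < S.N k := by linarith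
  rw [mem_closedBall_iff_norm] at hp hq
  have hcen := S.center_eq_of_floor_eq (ψ := ψ) hk
  set a := S.latticePoint x k (S.center ψ x k) with ha
  set b := S.latticePoint y k (S.center ψ y k) with hb
  have hab : (a - b) i = ((S.digit k x i : ℝ) - S.digit k y i) / S.N k := by
    rw [ha, hb, hcen]
    simp only [latticePoint, latticeIndex, PiLp.sub_apply, PiLp.smul_apply, intVec_apply,
      smul_eq_mul]
    push_cast
    field_simp
    ring
  have h1 : a - b = (p - q) - (p - S.center ψ x (k + 1)) + (q - S.center ψ y (k + 1))
      - ((S.N k : ℝ) ^ 2)⁻¹ • (ψ k a - ψ k b) := by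
    rw [center, center, ← ha, ← hb, smul_sub]; abel
  have h2 : ‖((S.N k : ℝ) ^ 2)⁻¹ • (ψ k a - ψ k b)‖ ≤ 1 / (S.N k : ℝ) ^ 2 / 10 := by
    rw [norm_smul, Real.norm_of_nonneg (by positivity), div_div, ← div_eq_inv_mul, ← div_div,
      div_right_comm]
    refine div_le_div_of_nonneg_right ?_ (by positivity)
    exact (norm_sub_le_add_of_le (hψ k a) (hψ k b)).trans (by norm_num)
  have h3 : S.δ (k + 1) ≤ 1 / (S.N k : ℝ) ^ 2 / 4 := by
    refine (S.δ_succ_le hε1 k).trans_eq ?_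
    rw [div_div, mul_comm]
  have h4 : ‖a - b‖ ≤ ‖p - q‖ + 1 / (S.N k : ℝ) ^ 2 := by
    rw [h1]
    refine (norm_sub_le _ _).trans ?_
    have := (norm_add_le (p - q - (p - S.center ψ x (k + 1))) (q - S.center ψ y (k + 1)))
    have := norm_sub_le (p - q) (p - S.center ψ x (k + 1))
    have : 0 ≤ 1 / (S.N k : ℝ) ^ 2 := by positivity
    linarith
  have h5 : |(S.digit k x i : ℝ) - S.digit k y i| / S.N k ≤ ‖p - q‖ + 1 / (S.N k : ℝ) ^ 2 := by
    have := PiLp.norm_apply_le (a - b) i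
    rw [hab, norm_div, Real.norm_natCast, Real.norm_eq_abs] at this
    exact this.trans h4
  have h6 : (1 : ℝ) ≤ |(S.digit k x i : ℝ) - S.digit k y i| := by
    exact_mod_cast Int.one_le_abs (sub_ne_zero.mpr hi)
  rw [div_le_iff₀ hN0] at h5
  have h7 : (‖p - q‖ + 1 / (S.N k : ℝ) ^ 2) * S.N k = S.N k * ‖p - q‖ + 1 / S.N k := by
    field_simp
  have h8 : 1 / (S.N k : ℝ) ≤ 1 / 6 := one_div_le_one_div_of_le (by norm_num) hN
  linarith

end CantorScale

namespace CantorScale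

variable {n : ℕ} {ε : ℕ → ℝ} (S : CantorScale n ε)
  {ψ : ℕ → EuclideanSpace ℝ (Fin n) → EuclideanSpace ℝ (Fin n)}

lemma exists_first_floor_ne {x y : Fin n → ℝ} (hx : ∀ i, x i ∈ Set.Ico (0 : ℝ) 1)
    (hy : ∀ i, y i ∈ Set.Ico (0 : ℝ) 1) (hxy : x ≠ y) :
    ∃ k, (∀ j ≤ k, ∀ i, ⌊S.P j * x i⌋ = ⌊S.P j * y i⌋) ∧
      ∃ i, ⌊S.P (k + 1) * x i⌋ ≠ ⌊S.P (k + 1) * y i⌋ := by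
  classical
  have hex : ∃ k, ∃ i, ⌊S.P k * x i⌋ ≠ ⌊S.P k * y i⌋ := by
    by_contra! h
    refine hxy (funext fun i => ?_)
    by_contra hi
    have hpos : 0 < |x i - y i| := abs_pos.mpr (sub_ne_zero.mpr hi)
    obtain ⟨k, hk⟩ := exists_nat_gt (1 / |x i - y i|)
    have h1 := Int.abs_sub_lt_one_of_floor_eq_floor (h k i)
    rw [← mul_sub, abs_mul, Nat.abs_cast] at h1
    have h2 : (k : ℝ) < S.P k := by exact_mod_cast S.lt_P k
    rw [div_lt_iff₀ hpos] at hk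
    nlinarith
  have hmin := fun j => Nat.find_min hex (m := j)
  have hspec := Nat.find_spec hex
  cases hK : Nat.find hex with
  | zero =>
    rw [hK] at hspec
    obtain ⟨i, hi⟩ := hspec
    rw [S.P_zero, Nat.cast_one, one_mul, one_mul, Int.floor_eq_zero_iff.mpr (hx i),
      Int.floor_eq_zero_iff.mpr (hy i)] at hi
    exact absurd rfl hi
  | succ k =>
    rw [hK] at hspec hmin
    refine ⟨k, fun j hj i => ?_, hspec⟩
    by_contra h
    exact hmin j (by omega) ⟨i, h⟩

/-- The correspondence from the Cantor set back to the cube is Hölder with exponent `r` as soon as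
`(P k)⁻¹ = O(δ k ^ r)`. -/
lemma dist_le_mul_rpow (hn : 0 < n) (hε : ∀ k, 0 < ε k) (hε1 : ∀ k, ε k ≤ 1)
    (hψ : ∀ k x, ‖ψ k x‖ ≤ 1 / 20) {r C : ℝ} (hr0 : 0 < r) (hr1 : r ≤ 1) (hC0 : 0 ≤ C)
    (hC : ∀ k, 1 ≤ C * (S.P k * S.δ k ^ r))
    {x y : Fin n → ℝ} (hx : ∀ i, x i ∈ Set.Ico (0 : ℝ) 1) (hy : ∀ i, y i ∈ Set.Ico (0 : ℝ) 1)
    {p q : EuclideanSpace ℝ (Fin n)}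
    (hp : ∀ k, p ∈ Metric.closedBall (S.center ψ x k) (S.δ k))
    (hq : ∀ k, q ∈ Metric.closedBall (S.center ψ y k) (S.δ k)) :
    dist x y ≤ 2 * C * (16 * n) ^ r * dist p q ^ r := by
  have hbound : 0 ≤ 2 * C * (16 * (n : ℝ)) ^ r * dist p q ^ r := by positivity
  rcases eq_or_ne x y with rfl | hxy
  · rwa [dist_self]
  obtain ⟨k, hk, i₀, hi₀⟩ := S.exists_first_floor_ne hx hy hxy
  have hdig : ∀ i, S.digit k x i - S.digit k y i
      = ⌊S.P (k + 1) * x i⌋ - ⌊S.P (k + 1) * y i⌋ := by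
    intro i
    rw [digit, digit, hk k le_rfl i]
    ring
  have hM : (0 : ℝ) < S.M k := by exact_mod_cast (show 0 < S.M k by have := S.two_le_M k; omega)
  have hP : (0 : ℝ) < S.P k := by exact_mod_cast S.P_pos k
  have hδ := S.δ_pos hε k
  set T : ℝ := 2 * S.N k * ‖p - q‖ with hT
  have hT0 : ∀ i, S.digit k x i ≠ S.digit k y i →
      |(S.digit k x i : ℝ) - S.digit k y i| ≤ T :=
    fun i hi => S.abs_digit_sub_le hε1 hψ hk (hp (k + 1)) (hq (k + 1)) hi
  have hT1 : 1 ≤ T := by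
    have hne : S.digit k x i₀ - S.digit k y i₀ ≠ 0 := by rw [hdig]; exact sub_ne_zero.mpr hi₀
    have h6 : (1 : ℝ) ≤ |(S.digit k x i₀ : ℝ) - S.digit k y i₀| := by
      exact_mod_cast Int.one_le_abs hne
    exact h6.trans (hT0 i₀ (sub_ne_zero.mp hne))
  refine (dist_pi_le_iff hbound).mpr fun i => ?_
  have h1 : |(S.digit k x i : ℝ) - S.digit k y i| ≤ T := by
    by_cases hi : S.digit k x i = S.digit k y i
    · rw [hi, sub_self, abs_zero]; linarith
    · exact hT0 i hi
  have h2 : |(S.digit k x i : ℝ) - S.digit k y i| + 1 ≤ S.M k := by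
    have a1 := S.digit_nonneg k x i
    have a2 := S.digit_nonneg k y i
    have a3 := S.digit_lt k x i
    have a4 := S.digit_lt k y i
    have : |S.digit k x i - S.digit k y i| + 1 ≤ S.M k := by
      rcases abs_cases (S.digit k x i - S.digit k y i) with h | h <;> omega
    exact_mod_cast this
  have h3 : (|(S.digit k x i : ℝ) - S.digit k y i| + 1) / S.M k ≤ 2 * (T / S.M k) ^ r := by
    rcases le_total 1 (T / S.M k) with h | h
    · have := Real.one_le_rpow h hr0.le
      have h4 : (|(S.digit k x i : ℝ) - S.digit k y i| + 1) / S.M k ≤ 1 := (div_le_one hM).mpr h2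
      linarith
    · have h4 : T / S.M k ≤ (T / S.M k) ^ r :=
        Real.self_le_rpow_of_le_one (by positivity) h hr1
      have h5 : (|(S.digit k x i : ℝ) - S.digit k y i| + 1) / S.M k ≤ 2 * (T / S.M k) := by
        rw [mul_div_assoc']
        exact div_le_div_of_nonneg_right (by linarith) hM.le
      linarith
  have h4 : |x i - y i| * (S.P k * S.M k) ≤ |(S.digit k x i : ℝ) - S.digit k y i| + 1 := by
    have e1 : (S.digit k x i : ℝ) - S.digit k y i
        = ⌊S.P (k + 1) * x i⌋ - ⌊S.P (k + 1) * y i⌋ := by exact_mod_cast hdig i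
    have e2 : |x i - y i| * (S.P k * S.M k) = |S.P (k + 1) * x i - S.P (k + 1) * y i| := by
      rw [← mul_sub, abs_mul, Nat.abs_cast, S.P_succ]; push_cast; ring
    rw [e1, e2]
    have f1 := Int.floor_le (S.P (k + 1) * x i)
    have f2 := Int.lt_floor_add_one (S.P (k + 1) * x i)
    have f3 := Int.floor_le (S.P (k + 1) * y i)
    have f4 := Int.lt_floor_add_one (S.P (k + 1) * y i)
    have f5 := le_abs_self ((⌊S.P (k + 1) * x i⌋ : ℝ) - ⌊S.P (k + 1) * y i⌋)
    have f6 := neg_abs_le ((⌊S.P (k + 1) * x i⌋ : ℝ) - ⌊S.P (k + 1) * y i⌋)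
    rw [abs_le]
    constructor <;> linarith
  have h5 : |x i - y i| * S.P k ≤ 2 * (T / S.M k) ^ r := by
    refine le_trans ?_ h3
    rw [le_div_iff₀ hM]
    linarith
  have h6 : S.δ k * (T / S.M k) ≤ 16 * n * dist p q := by
    rw [dist_eq_norm, mul_div_assoc', div_le_iff₀ hM, hT]
    nlinarith [S.le_M k, norm_nonneg (p - q)]
  calc dist (x i) (y i) = |x i - y i| * 1 := by rw [Real.dist_eq, mul_one]
    _ ≤ |x i - y i| * (C * (S.P k * S.δ k ^ r)) :=
        mul_le_mul_of_nonneg_left (hC k) (abs_nonneg _)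
    _ = C * S.δ k ^ r * (|x i - y i| * S.P k) := by ring
    _ ≤ C * S.δ k ^ r * (2 * (T / S.M k) ^ r) :=
        mul_le_mul_of_nonneg_left h5 (by positivity)
    _ = 2 * C * (S.δ k * (T / S.M k)) ^ r := by
        rw [Real.mul_rpow hδ.le (by positivity)]; ring
    _ ≤ 2 * C * (16 * n * dist p q) ^ r := by gcongr
    _ = 2 * C * (16 * n) ^ r * dist p q ^ r := by
        rw [Real.mul_rpow (by positivity) dist_nonneg]; ring

open Filter in
lemma exists_growth_const (hε : ∀ k, 0 < ε k) (hε1 : ∀ k, ε k ≤ 1) {r : ℝ} (hr : r < 1 / 2) :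
    ∃ C : ℝ, 0 ≤ C ∧ ∀ k, 1 ≤ C * (S.P k * S.δ k ^ r) := by
  have hpos : ∀ k, 0 < S.P k * S.δ k ^ r := fun k =>
    mul_pos (by exact_mod_cast S.P_pos k) (Real.rpow_pos_of_pos (S.δ_pos hε k) _)
  have hev : ∀ᶠ k in atTop, (S.P k * S.δ k ^ r)⁻¹ ≤ 1 := by
    obtain ⟨m, hm⟩ := exists_nat_one_div_lt (sub_pos.mpr hr)
    filter_upwards [eventually_ge_atTop (m + 1)] with k' hk'
    obtain ⟨k, rfl⟩ : ∃ k, k' = k + 1 := ⟨k' - 1, by omega⟩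
    have hk : m ≤ k := by omega
    refine inv_le_one_of_one_le₀ ((S.growth k).trans ?_)
    have hmk : (1 : ℝ) / (k + 3) ≤ 1 / (m + 1) := by
      have : (m : ℝ) ≤ k := by exact_mod_cast hk
      exact one_div_le_one_div_of_le (by positivity) (by linarith)
    exact mul_le_mul_of_nonneg_left (Real.rpow_le_rpow_of_exponent_ge (S.δ_pos hε _)
      (S.δ_le_one hε1 _) (by linarith)) (Nat.cast_nonneg _)
  obtain ⟨C, hC⟩ := (isBoundedUnder_of_eventually_le hev).bddAbove_range
  have hC' : ∀ k, (S.P k * S.δ k ^ r)⁻¹ ≤ C := fun k => hC ⟨k, rfl⟩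
  refine ⟨C, (inv_nonneg.mpr (hpos 0).le).trans (hC' 0), fun k => ?_⟩
  have := mul_le_mul_of_nonneg_right (hC' k) (hpos k).le
  rwa [inv_mul_cancel₀ (hpos k).ne'] at this

end CantorScale

/-! ### Dimension from an inverse Hölder estimate -/

/-- If the unit cube embeds into `E` with a Hölder inverse of exponent `r`, for every `r < 1 / 2`,
then `E` has dimension at least `n / 2`. -/
lemma le_dimH_of_inverse_holder {n : ℕ} (hn : 0 < n) {X : Type*} [MetricSpace X] {E : Set X}
    {h : (Fin n → ℝ) → X} (hE : ∀ x, h x ∈ E)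
    (hh : ∀ r : ℝ, 0 < r → r < 1 / 2 → ∃ D : ℝ, 0 ≤ D ∧
      ∀ x ∈ Set.univ.pi fun _ : Fin n => Set.Ico (0 : ℝ) 1,
      ∀ y ∈ Set.univ.pi fun _ : Fin n => Set.Ico (0 : ℝ) 1, dist x y ≤ D * dist (h x) (h y) ^ r) :
    (n : ENNReal) / 2 ≤ dimH E := by
  set Q : Set (Fin n → ℝ) := Set.univ.pi fun _ : Fin n => Set.Ico (0 : ℝ) 1 with hQ
  have hn' : (0 : NNReal) < n := by exact_mod_cast hn
  have hdimQ : dimH Q = n := by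
    have hint : (interior Q).Nonempty := by
      rw [hQ, interior_pi_set Set.finite_univ]
      exact ⟨fun _ => 1 / 2, fun i _ => by rw [interior_Ico]; constructor <;> norm_num⟩
    rw [Real.dimH_of_nonempty_interior hint, Module.finrank_fin_fun]
  refine ENNReal.le_of_forall_nnreal_lt fun t ht => ?_
  rcases eq_or_ne t 0 with rfl | ht0
  · simp
  have ht' : t < n / 2 := by
    have hcast : (((n : NNReal) / 2 : NNReal) : ENNReal) = (n : ENNReal) / 2 := by
      rw [ENNReal.coe_div two_ne_zero]; simp
    rw [← hcast] at ht
    exact_mod_cast ht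
  set r : NNReal := t / n with hr
  have hr0 : 0 < r := div_pos (pos_iff_ne_zero.mpr ht0) hn'
  have hr1 : r < 1 / 2 := by
    rw [hr, div_lt_iff₀ hn', one_div_mul_eq_div]; exact ht'
  have hr1' : (r : ℝ) < 1 / 2 := by exact_mod_cast hr1
  obtain ⟨D, hD, hdist⟩ := hh r (by exact_mod_cast hr0) hr1'
  have hinj : Set.InjOn h Q := fun x hx y hy hxy => by
    have := hdist x hx y hy
    rw [hxy, dist_self, Real.zero_rpow (by exact_mod_cast hr0.ne'), mul_zero] at this
    exact dist_le_zero.mp this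
  have hleft := hinj.leftInvOn_invFunOn
  have hhol : HolderOnWith D.toNNReal r (Function.invFunOn h Q) (h '' Q) := by
    rintro _ ⟨x, hx, rfl⟩ _ ⟨y, hy, rfl⟩
    rw [hleft hx, hleft hy, edist_dist, edist_dist,
      ENNReal.ofReal_rpow_of_nonneg dist_nonneg NNReal.zero_le_coe, ← ENNReal.ofReal,
      ← ENNReal.ofReal_mul hD]
    exact ENNReal.ofReal_le_ofReal (hdist x hx y hy)
  have hle := hhol.dimH_image_le hr0
  rw [hleft.image_image, hdimQ] at hle
  have hle2 : (n : ENNReal) ≤ dimH E / r :=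
    hle.trans (ENNReal.div_le_div_right (dimH_mono (Set.image_subset_iff.mpr fun x _ => hE x)) _)
  rw [ENNReal.le_div_iff_mul_le (Or.inl (by exact_mod_cast hr0.ne'))
    (Or.inl ENNReal.coe_ne_top)] at hle2
  refine le_trans (le_of_eq ?_) hle2
  rw [hr, ← ENNReal.coe_natCast, ← ENNReal.coe_mul, mul_div_cancel₀ _ hn'.ne']

/-- A compact set of dimension `n / 2` all of whose points lie near the `k`-th lattice, as displaced
by `ψ k`, for every `k`. -/
lemma exists_isCompact_dimH_eq_subset_nearLattice {n : ℕ} (hn : 0 < n)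
    {ψ : ℕ → EuclideanSpace ℝ (Fin n) → EuclideanSpace ℝ (Fin n)} {ε : ℕ → ℝ}
    (hψ : ∀ k x, ‖ψ k x‖ ≤ 1 / 20) (hψL : ∀ k x y, ‖ψ k x - ψ k y‖ ≤ ‖x - y‖)
    (hε : ∀ k, 0 < ε k) (hε1 : ∀ k, ε k ≤ 1) :
    ∃ (E : Set (EuclideanSpace ℝ (Fin n))) (N : ℕ → ℕ), IsCompact E ∧
      dimH E = (n : ENNReal) / 2 ∧ (∀ k, 0 < N k) ∧ (∀ k, 1 ≤ ε k * (N k : ℝ) ^ 2) ∧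
      ∀ k, E ⊆ nearLattice (N k) (ψ k) (ε k) ∩ Metric.closedBall 0 1 := by
  obtain ⟨S⟩ := exists_cantorScale hn hε
  have hψc : ∀ k, Continuous (ψ k) := fun k => by
    refine (LipschitzWith.of_dist_le_mul (K := 1) fun x y => ?_).continuous
    rw [NNReal.coe_one, one_mul, dist_eq_norm, dist_eq_norm]
    exact hψL k x y
  set E := ⋂ k, nearLattice (S.N k) (ψ k) (ε k) ∩ Metric.closedBall 0 1 with hE
  have hsub : ∀ k, E ⊆ nearLattice (S.N k) (ψ k) (ε k) ∩ Metric.closedBall 0 1 :=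
    fun k => Set.iInter_subset _ k
  choose h hh using S.exists_mem_closedBall_center hn hε hε1 hψ
  refine ⟨E, S.N, ?_, le_antisymm ?_ ?_, S.N_pos, fun k => ?_, hsub⟩
  · exact (isCompact_closedBall (0 : EuclideanSpace ℝ (Fin n)) 1).of_isClosed_subset
      (isClosed_iInter fun k =>
        isClosed_nearLattice_inter_closedBall (hψ k) (hψc k) (hε1 k) (S.N_pos k))
      ((hsub 0).trans Set.inter_subset_right)
  · exact dimH_le_of_subset_nearLattice hψ hε1 S.N_pos
      (Filter.tendsto_atTop_mono S.le_N Filter.tendsto_id) hsub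
  · refine le_dimH_of_inverse_holder hn (h := h) (fun x => Set.mem_iInter.mpr fun k =>
      ⟨S.mem_nearLattice_of_mem_closedBall_center hψL hψ (hh x (k + 1)), ?_⟩)
      fun r hr0 hr1 => ?_
    · have := hh x 0
      rwa [S.δ_zero, CantorScale.center] at this
    · obtain ⟨C, hC0, hC⟩ := S.exists_growth_const hε hε1 hr1
      exact ⟨2 * C * (16 * n) ^ r, by positivity, fun x hx y hy =>
        S.dist_le_mul_rpow hn hε hε1 hψ hr0 (by linarith) hC0 hC (fun i => hx i trivial)
          (fun i => hy i trivial) (hh x) (hh y)⟩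
  · linarith [S.four_le_N_sq k]

/-! ### The set without right angles -/

theorem theorem3p1 (n : ℕ) (hn : 2 ≤ n) :
    ∃ E : Set (EuclideanSpace ℝ (Fin n)),
      IsCompact E ∧
      dimH E = (n : ENNReal) / 2 ∧
      (∀ x ∈ E, ∀ y ∈ E, ∀ z ∈ E, x ≠ y → x ≠ z → y ≠ z →
        EuclideanGeometry.angle y x z ≠ Real.pi / 2) ∧
      (∀ x ∈ E, ∀ y ∈ E, ∀ z ∈ E, ∀ v ∈ E, x ≠ y → z ≠ v →
        inner ℝ (x - y) (z - v) ≠ 0) := by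
  obtain ⟨ψ, ε, hψ, hψL, hε, hε1, hsep⟩ := exists_displacements (n := n) (by omega)
  obtain ⟨E, N, hcomp, hdim, hN, hNε, hsub⟩ :=
    exists_isCompact_dimH_eq_subset_nearLattice (n := n) (by omega) hψ hψL hε hε1
  have hinner : ∀ x ∈ E, ∀ y ∈ E, ∀ z ∈ E, ∀ v ∈ E, x ≠ y → z ≠ v →
      inner ℝ (x - y) (z - v) ≠ 0 := by
    intro x hx y hy z hz v hv hxy hzv
    obtain ⟨k, hk⟩ := hsep x y z v hxy hzv
    have hnear : ∀ p ∈ E, p ∈ nearLattice (N k) (ψ k) (ε k) := fun p hp => (hsub k hp).1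
    have hball : ∀ p ∈ E, ‖p‖ ≤ 1 := fun p hp => mem_closedBall_zero_iff.mp (hsub k hp).2
    exact inner_ne_zero_of_mem_nearLattice (hψ k) (hε k) (hε1 k) (hN k) (hNε k)
      (hnear x hx) (hnear y hy) (hnear z hz) (hnear v hv)
      (hball x hx) (hball y hy) (hball z hz) (hball v hv) hk
  refine ⟨E, hcomp, hdim, fun x hx y hy z hz hxy hxz _ hangle => ?_, hinner⟩
  exact hinner y hy x hx z hz x hx hxy.symm hxz.symm
    (InnerProductGeometry.inner_eq_zero_iff_angle_eq_pi_div_two _ _ |>.mpr hangle)
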